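/- Let $k$ be a field and let $n, m \ge 0$ be integers. If there exists an embedding over $k$ (that is, a morphism of $k$-schemes which is a closed immersion) of $\mathbb{P}^n_k \times_k \mathbb{P}^1_k$ into $\mathbb{P}^m_k$, then $m \ge 2n+1$. -/

import Mathlib

open AlgebraicGeometry CategoryTheory CategoryTheory.Limits

noncomputable section

attribute [local instance] MvPolynomial.gradedAlgebra

/-- Projective `n`-space over `k`: the scheme `Proj k[x₀, …, xₙ]`, where the polynomial ring
carries its standard grading by total degree. -/
def projectiveSpace (k : Type*) [Field k] (n : ℕ) : Scheme :=
  Proj (MvPolynomial.homogeneousSubmodule (Fin (n + 1)) k)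

/-- The structure morphism `ℙⁿ ⟶ Spec k`: the canonical morphism from `Proj` to the spectrum of
the degree-zero part, followed by the morphism induced by `k → k[x₀, …, xₙ]₀`. -/
def projectiveSpaceToSpec (k : Type*) [Field k] (n : ℕ) :
    projectiveSpace k n ⟶ Spec (CommRingCat.of k) :=
  Proj.toSpecZero (MvPolynomial.homogeneousSubmodule (Fin (n + 1)) k) ≫
    Spec.map (CommRingCat.ofHom
      (algebraMap k (MvPolynomial.homogeneousSubmodule (Fin (n + 1)) k 0)))

/-- The product `ℙⁿ × ℙᵐ` over `k`: the fibre product over `Spec k`. -/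
def projectiveProduct (k : Type*) [Field k] (n m : ℕ) : Scheme :=
  pullback (projectiveSpaceToSpec k n) (projectiveSpaceToSpec k m)

/-- The structure morphism `ℙⁿ × ℙᵐ ⟶ Spec k`. -/
def projectiveProductToSpec (k : Type*) [Field k] (n m : ℕ) :
    projectiveProduct k n m ⟶ Spec (CommRingCat.of k) :=
  pullback.fst (projectiveSpaceToSpec k n) (projectiveSpaceToSpec k m) ≫
    projectiveSpaceToSpec k n

end

noncomputable section

attribute [local instance] MvPolynomial.gradedAlgebra

open scoped TensorProduct

/-! The slices of `ℙⁿ × ℙ¹` over `(1 : 0)` and `(1 : 1)` embed as disjoint closed copies of `ℙⁿ` in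
`ℙᵐ`, and the projective dimension theorem forbids this unless `n + n < m`
(`two_mul_lt_of_disjoint_range`).

That theorem is proved on affine cones by reduction to the diagonal. Let `I`, `J` be homogeneous
ideals whose sum contains a power of every variable, and let `A`, `B` be the quotients of the
polynomial ring by them. Then `A ⊗ B` is integral over the subalgebra generated by the differences
`xᵢ ⊗ 1 - 1 ⊗ xᵢ` (`isIntegral_of_aeval_eq_pow`, applied modulo a prime), so at most as many
elements as there are variables are algebraically independent. Noether normalization of `A` and `B`
supplies `dim A + dim B` such elements (`card_le_of_pow_mem_sup`). Passing from a projective variety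
to its cone raises the dimension by one. -/

/-! ### Krull dimension and algebraically independent families -/

theorem ringKrullDim_le_of_isIntegral (R A : Type*) [CommRing R] [CommRing A] [Algebra R A]
    [Algebra.IsIntegral R A] : ringKrullDim A ≤ ringKrullDim R := by
  refine Order.krullDim_le_of_strictMono (PrimeSpectrum.comap (algebraMap R A)) fun p q h ↦ ?_
  exact Ideal.IsIntegral.comap_lt_comap (I := p.asIdeal) (J := q.asIdeal) h

/-- Noether normalization embeds a polynomial ring in `s ≥ dim A` variables; `d` of them are kept.
-/
theorem exists_injective_mvPolynomial_algHom (k A : Type*) [Field k] [CommRing A] [Algebra k A]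
    [Nontrivial A] [Algebra.FiniteType k A] (d : ℕ) (hd : (d : WithBot ℕ∞) ≤ ringKrullDim A) :
    ∃ g : MvPolynomial (Fin d) k →ₐ[k] A, Function.Injective g := by
  obtain ⟨s, g, hg, hint⟩ := exists_integral_inj_algHom_of_fg k A
  have hs : ringKrullDim A ≤ s := by
    algebraize [g.toRingHom]
    have : Algebra.IsIntegral (MvPolynomial (Fin s) k) A := ⟨hint⟩
    simpa [MvPolynomial.ringKrullDim_of_isNoetherianRing] using
      ringKrullDim_le_of_isIntegral (MvPolynomial (Fin s) k) A
  have hds : d ≤ s := by exact_mod_cast hd.trans hs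
  exact ⟨g.comp (MvPolynomial.rename (Fin.castLE hds)),
    hg.comp (MvPolynomial.rename_injective _ (Fin.castLE_injective hds))⟩

/-- Independence is injectivity of evaluation, and `A` is flat over the field `k`. -/
theorem AlgebraicIndependent.one_tmul {k A B ι : Type*} [Field k] [CommRing A] [Algebra k A]
    [CommRing B] [Algebra k B] {y : ι → B} (hy : AlgebraicIndependent k y) :
    AlgebraicIndependent A fun i ↦ (1 : A) ⊗ₜ[k] y i := by
  have h : MvPolynomial.aeval (fun i ↦ (1 : A) ⊗ₜ[k] y i) =
      (Algebra.TensorProduct.map (AlgHom.id A A) (MvPolynomial.aeval y)).comp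
        (MvPolynomial.algebraTensorAlgEquiv (σ := ι) k A).symm.toAlgHom := by
    ext i
    simp
  rw [AlgebraicIndependent, h]
  refine Function.Injective.comp (g := Algebra.TensorProduct.map _ _) ?_
    (MvPolynomial.algebraTensorAlgEquiv (σ := ι) k A).symm.injective
  exact Module.Flat.lTensor_preserves_injective_linearMap (M := A)
    (MvPolynomial.aeval (R := k) y).toLinearMap hy

theorem AlgebraicIndependent.sumElim_tmul {k A B ι κ : Type*} [Field k] [CommRing A] [Algebra k A]
    [CommRing B] [Algebra k B] {x : κ → A} {y : ι → B} (hx : AlgebraicIndependent k x)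
    (hy : AlgebraicIndependent k y) :
    AlgebraicIndependent k
      (Sum.elim (fun i ↦ (1 : A) ⊗ₜ[k] y i) (fun i ↦ x i ⊗ₜ[k] (1 : B))) :=
  hx.sumElim_comp (A := A ⊗[k] B) hy.one_tmul

/-! ### Filtration by monomial degree and integrality over the differences -/

section Filtration

variable {σ K : Type*} [CommRing K] (D : Type*) [CommRing D] [Algebra D K] (u : σ → K)

/-- The `D`-submodule spanned by the monomials of degree at most `j` in the family `u`. -/
def monomialSpan (j : ℕ) : Submodule D K :=
  Submodule.span D ((fun t : Multiset σ ↦ (t.map u).prod) '' {t | t.card ≤ j})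

variable {D u}

theorem prod_mem_monomialSpan {j : ℕ} {t : Multiset σ} (ht : t.card ≤ j) :
    (t.map u).prod ∈ monomialSpan D u j :=
  Submodule.subset_span ⟨t, ht, rfl⟩

theorem monomialSpan_mono {i j : ℕ} (h : i ≤ j) : monomialSpan D u i ≤ monomialSpan D u j :=
  Submodule.span_mono (Set.image_mono fun _ ht ↦ le_trans ht h)

theorem mul_prod_mem_monomialSpan {j : ℕ} {x : K} (hx : x ∈ monomialSpan D u j) (t : Multiset σ) :
    x * (t.map u).prod ∈ monomialSpan D u (j + t.card) := by
  induction hx using Submodule.span_induction with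
  | mem x hx =>
    obtain ⟨s, hs, rfl⟩ := hx
    rw [← Multiset.prod_add, ← Multiset.map_add]
    exact prod_mem_monomialSpan (by simpa using hs)
  | zero => simp
  | add x y _ _ hx hy => rw [add_mul]; exact add_mem hx hy
  | smul a x _ hx => rw [smul_mul_assoc]; exact Submodule.smul_mem _ _ hx

theorem mul_mem_monomialSpan {j : ℕ} {x : K} (hx : x ∈ monomialSpan D u j) (i : σ) :
    u i * x ∈ monomialSpan D u (j + 1) := by
  simpa [mul_comm] using mul_prod_mem_monomialSpan hx {i}

variable {v : σ → K} (huv : ∀ i, ∃ d : D, u i - v i = algebraMap D K d)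
include huv

theorem prod_mem_monomialSpan_of_sub (t : Multiset σ) :
    (t.map v).prod ∈ monomialSpan D u t.card := by
  induction t using Multiset.induction_on with
  | empty => exact prod_mem_monomialSpan (t := 0) le_rfl
  | cons i t ih =>
    obtain ⟨d, hd⟩ := huv i
    have : v i = u i - algebraMap D K d := by rw [← hd]; ring
    rw [Multiset.map_cons, Multiset.prod_cons, Multiset.card_cons, this, sub_mul, ← Algebra.smul_def]
    exact sub_mem (mul_mem_monomialSpan ih i)
      (Submodule.smul_mem _ _ (monomialSpan_mono (Nat.le_succ _) ih))

/-- Substituting `v i = u i - d i` with `d i` in `D` leaves the leading monomial unchanged, so the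
top-degree parts cancel. -/
theorem prod_sub_prod_mem_monomialSpan (t : Multiset σ) (j : ℕ) (ht : t.card ≤ j + 1) :
    (t.map u).prod - (t.map v).prod ∈ monomialSpan D u j := by
  induction t using Multiset.induction_on generalizing j with
  | empty => simp
  | cons i t ih =>
    obtain ⟨d, hd⟩ := huv i
    have hv : v i = u i - algebraMap D K d := by rw [← hd]; ring
    have key : u i * (t.map u).prod - v i * (t.map v).prod =
        u i * ((t.map u).prod - (t.map v).prod) + d • (t.map v).prod := by
      rw [hv, Algebra.smul_def]; ring
    rw [Multiset.card_cons] at ht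
    rw [Multiset.map_cons, Multiset.prod_cons, Multiset.map_cons, Multiset.prod_cons, key]
    refine add_mem ?_ (Submodule.smul_mem _ _
      (monomialSpan_mono (by omega) (prod_mem_monomialSpan_of_sub huv t)))
    cases j with
    | zero =>
      obtain rfl : t = 0 := by simpa using ht
      simp
    | succ j => exact mul_mem_monomialSpan (ih j (by omega)) i

theorem aeval_sub_aeval_mem_monomialSpan {k : Type*} [CommRing k] [Algebra k K] [Algebra k D]
    [IsScalarTower k D K] (p : MvPolynomial σ k) (j : ℕ) (hp : p.totalDegree ≤ j + 1) :
    MvPolynomial.aeval u p - MvPolynomial.aeval v p ∈ monomialSpan D u j := by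
  rw [MvPolynomial.aeval_def, MvPolynomial.aeval_def, MvPolynomial.eval₂_eq, MvPolynomial.eval₂_eq,
    ← Finset.sum_sub_distrib]
  refine sum_mem fun s hs ↦ ?_
  have h (w : σ → K) : ∏ i ∈ s.support, w i ^ s i = (s.toMultiset.map w).prod := by
    rw [Finsupp.toMultiset_map, Finsupp.prod_toMultiset, Finsupp.prod_mapDomain_index (by simp)
      (by simp [pow_add])]
    rfl
  rw [← mul_sub, h, h, ← Algebra.smul_def, ← IsScalarTower.algebraMap_smul D]
  refine Submodule.smul_mem _ _ (prod_sub_prod_mem_monomialSpan huv _ _ ?_)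
  rw [Finsupp.card_toMultiset]
  exact (MvPolynomial.le_totalDegree hs).trans hp

/-- Since `u i ^ (N + 1) = p i (u) - p i (v)`, this power is a `D`-combination of monomials of
degree at most `N`. Monomials of large degree therefore reduce to lower ones, and a finitely
generated span is stable under multiplication by `u i`. -/
theorem isIntegral_of_aeval_eq_pow [IsDomain K] [Finite σ] {k : Type*} [CommRing k] [Algebra k K]
    [Algebra k D] [IsScalarTower k D K] (N : ℕ) (p : σ → MvPolynomial σ k)
    (hp : ∀ i, (p i).totalDegree ≤ N + 1) (hpu : ∀ i, MvPolynomial.aeval u (p i) = u i ^ (N + 1))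
    (hpv : ∀ i, MvPolynomial.aeval v (p i) = 0) (i : σ) : IsIntegral D (u i) := by
  classical
  have := Fintype.ofFinite σ
  have hpow (e : σ) : u e ^ (N + 1) ∈ monomialSpan D u N := by
    simpa [hpu, hpv] using aeval_sub_aeval_mem_monomialSpan huv (p e) N (hp e)
  -- By pigeonhole, a monomial of degree above `L` contains some `u e ^ (N + 1)`.
  set L := Fintype.card σ * (N + 1)
  refine isIntegral_of_smul_mem_submodule (monomialSpan D u L) (fun h ↦ ?_) ?_ _ ?_
  · have : (1 : K) ∈ monomialSpan D u L := prod_mem_monomialSpan (t := 0) (Nat.zero_le _)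
    simp [h] at this
  -- Finitely many multisets qualify: each index occurs at most `L` times.
  · refine Submodule.fg_span (Set.Finite.image _ ?_)
    refine ((Set.finite_Iic (L • (Finset.univ : Finset σ).val))).subset fun t ht ↦ ?_
    refine Multiset.le_iff_count.mpr fun a ↦ ?_
    simpa using (Multiset.count_le_card a t).trans ht
  · intro x hx
    rw [smul_eq_mul]
    induction hx using Submodule.span_induction with
    | zero => simp
    | add x y _ _ hx hy => rw [mul_add]; exact add_mem hx hy
    | smul a x _ hx => rw [mul_smul_comm]; exact Submodule.smul_mem _ _ hx
    | mem x hx =>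
      obtain ⟨t, ht, rfl⟩ := hx
      change t.card ≤ L at ht
      change u i * (t.map u).prod ∈ _
      rw [← Multiset.prod_cons, ← Multiset.map_cons]
      by_cases hc : (i ::ₘ t).card ≤ L
      · exact prod_mem_monomialSpan hc
      obtain ⟨e, -, he⟩ : ∃ e ∈ Finset.univ, N + 1 < (i ::ₘ t).count e := by
        refine Finset.exists_lt_of_sum_lt ?_
        rw [Multiset.sum_count_eq_card (fun _ _ ↦ Finset.mem_univ _)]
        simpa [L] using hc
      obtain ⟨r, hr⟩ := Multiset.le_iff_exists_add.mp (Multiset.le_count_iff_replicate_le.mp he.le)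
      have hcard := congrArg Multiset.card hr
      rw [Multiset.card_cons, Multiset.card_add, Multiset.card_replicate] at hcard
      rw [hr, Multiset.map_add, Multiset.prod_add, Multiset.map_replicate, Multiset.prod_replicate]
      exact monomialSpan_mono (by omega) (mul_prod_mem_monomialSpan (hpow e) r)

end Filtration

/-! ### Dimension inequality for affine cones -/

theorem card_add_card_le_of_algebraicIndependent {k A B : Type*} [Field k] [CommRing A]
    [Algebra k A] [CommRing B] [Algebra k B] {m a b : ℕ} (φ : MvPolynomial (Fin m) k →ₐ[k] A)
    (hφ : Function.Surjective φ) (ψ : MvPolynomial (Fin m) k →ₐ[k] B)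
    (hψ : Function.Surjective ψ) (N : ℕ) (q : Fin m → MvPolynomial (Fin m) k)
    (hqdeg : ∀ i, (q i).totalDegree ≤ N + 1)
    (hqφ : ∀ i, φ (q i) = φ (MvPolynomial.X i ^ (N + 1))) (hqψ : ∀ i, ψ (q i) = 0)
    {x : Fin a → A} (hx : AlgebraicIndependent k x) {y : Fin b → B}
    (hy : AlgebraicIndependent k y) : a + b ≤ m := by
  have hz := hx.sumElim_tmul hy
  set z := Sum.elim (fun i ↦ (1 : A) ⊗ₜ[k] y i) (fun i ↦ x i ⊗ₜ[k] (1 : B))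
  -- `A ⊗ B` need not be a domain. The zero ideal is a minimal prime of the polynomial ring embedded
  -- by `z`, so some prime `P` contracts to it, and `z` stays independent modulo `P`.
  obtain ⟨P, hP, hPz⟩ := Ideal.exists_comap_eq_of_mem_minimalPrimes_of_injective
    (f := (MvPolynomial.aeval z : _ →ₐ[k] A ⊗[k] B).toRingHom) hz ⊥
    (by simp [IsDomain.minimalPrimes_eq_singleton_bot])
  let π : A ⊗[k] B →ₐ[k] (A ⊗[k] B) ⧸ P := Ideal.Quotient.mkₐ k P
  have hzK : AlgebraicIndependent k (π ∘ z) := by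
    refine (injective_iff_map_eq_zero _).mpr fun p hp ↦ ?_
    have h : π (MvPolynomial.aeval z p) = 0 := by
      rw [← hp]
      exact DFunLike.congr_fun (MvPolynomial.comp_aeval z π) p
    have hp' : MvPolynomial.aeval z p ∈ P := Ideal.Quotient.eq_zero_iff_mem.mp h
    have : p ∈ P.comap (MvPolynomial.aeval z : _ →ₐ[k] A ⊗[k] B).toRingHom := hp'
    rwa [hPz] at this
  let α : MvPolynomial (Fin m) k →ₐ[k] (A ⊗[k] B) ⧸ P :=
    π.comp (Algebra.TensorProduct.includeLeft.comp φ)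
  let β : MvPolynomial (Fin m) k →ₐ[k] (A ⊗[k] B) ⧸ P :=
    π.comp (Algebra.TensorProduct.includeRight.comp ψ)
  let u : Fin m → (A ⊗[k] B) ⧸ P := fun i ↦ α (MvPolynomial.X i)
  let v : Fin m → (A ⊗[k] B) ⧸ P := fun i ↦ β (MvPolynomial.X i)
  have hu : MvPolynomial.aeval u = α := (MvPolynomial.aeval_unique α).symm
  have hv : MvPolynomial.aeval v = β := (MvPolynomial.aeval_unique β).symm
  let S : Set ((A ⊗[k] B) ⧸ P) := Set.range fun i ↦ u i - v i
  let D := Algebra.adjoin k S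
  have huv (i) : ∃ d : D, u i - v i = algebraMap D _ d :=
    ⟨⟨_, Algebra.subset_adjoin ⟨i, rfl⟩⟩, rfl⟩
  have huint (i) : IsIntegral D (u i) := by
    refine isIntegral_of_aeval_eq_pow huv _ q hqdeg (fun i ↦ ?_) (fun i ↦ ?_) i
    · rw [hu, ← map_pow]
      simp [α, hqφ]
    · rw [hv]
      simp [β, hqψ]
  have hvint (i) : IsIntegral D (v i) := by
    obtain ⟨d, hd⟩ := huv i
    rw [show v i = u i - algebraMap D _ d by rw [← hd]; ring]
    exact (huint i).sub isIntegral_algebraMap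
  have hαint (p) : IsIntegral D (α p) := by
    rw [← hu]
    induction p using MvPolynomial.induction_on with
    | C c =>
      rw [MvPolynomial.aeval_C, IsScalarTower.algebraMap_apply k D]
      exact isIntegral_algebraMap
    | add p q hp hq => rw [map_add]; exact hp.add hq
    | mul_X p i hp => rw [map_mul, MvPolynomial.aeval_X]; exact hp.mul (huint i)
  have hβint (p) : IsIntegral D (β p) := by
    rw [← hv]
    induction p using MvPolynomial.induction_on with
    | C c =>
      rw [MvPolynomial.aeval_C, IsScalarTower.algebraMap_apply k D]
      exact isIntegral_algebraMap
    | add p q hp hq => rw [map_add]; exact hp.add hq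
    | mul_X p i hp => rw [map_mul, MvPolynomial.aeval_X]; exact hp.mul (hvint i)
  have hint : Algebra.IsIntegral D ((A ⊗[k] B) ⧸ P) := by
    refine ⟨fun x ↦ ?_⟩
    obtain ⟨x, rfl⟩ := Ideal.Quotient.mk_surjective x
    induction x using TensorProduct.induction_on with
    | zero => rw [map_zero]; exact isIntegral_zero
    | add x y hx hy => rw [map_add]; exact hx.add hy
    | tmul x y =>
      obtain ⟨x, rfl⟩ := hφ x
      obtain ⟨y, rfl⟩ := hψ y
      have := (hαint x).mul (hβint y)
      rwa [show α x * β y = Ideal.Quotient.mk P (φ x ⊗ₜ ψ y) by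
        simp [α, β, π, ← map_mul]] at this
  -- The quotient is algebraic over `D`, which is generated by at most `m` differences; this bounds
  -- its transcendence degree.
  have halg : Algebra.IsAlgebraic D ((A ⊗[k] B) ⧸ P) := Algebra.IsIntegral.isAlgebraic
  have h1 := hzK.lift_cardinalMk_le_trdeg
  have h2 := Algebra.IsAlgebraic.trdeg_le_cardinalMk k S
  have h3 : Cardinal.mk S ≤ m := by
    simpa [S] using Cardinal.mk_range_le_lift (f := fun i ↦ u i - v i)
  have h4 := h1.trans (Cardinal.lift_le.mpr (h2.trans h3))
  simp only [Cardinal.mk_sum, Cardinal.mk_fin, Cardinal.lift_natCast, Cardinal.lift_id,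
    Cardinal.lift_add] at h4
  have h5 : b + a ≤ m := by exact_mod_cast h4
  omega


/-- Homogeneity is what bounds degrees: if a power of `X i` is split along `I ⊔ J`, the components
of the same degree split it too. -/
theorem card_le_of_pow_mem_sup {k : Type*} [Field k] {m a b : ℕ}
    (I J : Ideal (MvPolynomial (Fin m) k))
    (hI : I.IsHomogeneous (MvPolynomial.homogeneousSubmodule (Fin m) k))
    (hJ : J.IsHomogeneous (MvPolynomial.homogeneousSubmodule (Fin m) k))
    (hIJ : ∀ i, MvPolynomial.X i ∈ (I ⊔ J).radical)
    (ha : (a : WithBot ℕ∞) ≤ ringKrullDim (MvPolynomial (Fin m) k ⧸ I))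
    (hb : (b : WithBot ℕ∞) ≤ ringKrullDim (MvPolynomial (Fin m) k ⧸ J)) :
    a + b ≤ m := by
  have hA : Nontrivial (MvPolynomial (Fin m) k ⧸ I) := by
    by_contra h
    rw [not_nontrivial_iff_subsingleton] at h
    simp [ringKrullDim_eq_bot_of_subsingleton] at ha
  have hB : Nontrivial (MvPolynomial (Fin m) k ⧸ J) := by
    by_contra h
    rw [not_nontrivial_iff_subsingleton] at h
    simp [ringKrullDim_eq_bot_of_subsingleton] at hb
  obtain ⟨g, hg⟩ := exists_injective_mvPolynomial_algHom k _ a ha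
  obtain ⟨g', hg'⟩ := exists_injective_mvPolynomial_algHom k _ b hb
  have hx := (MvPolynomial.algebraicIndependent_X (Fin a) k).map' hg
  have hy := (MvPolynomial.algebraicIndependent_X (Fin b) k).map' hg'
  choose N hN using hIJ
  -- A single exponent for all variables, made a successor to match `N + 1` in the preceding
  -- theorem.
  have hN' (i) : (MvPolynomial.X i : MvPolynomial (Fin m) k) ^ (∑ j, N j + 1) ∈ I ⊔ J :=
    Ideal.pow_mem_of_pow_mem _ (hN i)
      ((Finset.single_le_sum (fun _ _ ↦ Nat.zero_le _) (Finset.mem_univ i)).trans (Nat.le_succ _))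
  have hpoly (i) : ∃ q : MvPolynomial (Fin m) k, q.totalDegree ≤ ∑ j, N j + 1 ∧ q ∈ J ∧
      MvPolynomial.X i ^ (∑ j, N j + 1) - q ∈ I := by
    obtain ⟨p, hp, q, hq, hpq⟩ := Submodule.mem_sup.mp (hN' i)
    have hc := congrArg (MvPolynomial.homogeneousComponent (∑ j, N j + 1)) hpq
    rw [map_add, MvPolynomial.homogeneousComponent_of_mem
      (MvPolynomial.isHomogeneous_X_pow i (∑ j, N j + 1)), if_pos rfl] at hc
    refine ⟨MvPolynomial.homogeneousComponent (∑ j, N j + 1) q,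
      (MvPolynomial.homogeneousComponent_isHomogeneous _ _).totalDegree_le, ?_, ?_⟩
    · rw [← MvPolynomial.decomposition.decompose'_apply]
      exact hJ _ hq
    · rw [← hc, add_sub_cancel_right, ← MvPolynomial.decomposition.decompose'_apply]
      exact hI _ hp
  choose q hqdeg hqJ hqI using hpoly
  refine card_add_card_le_of_algebraicIndependent (Ideal.Quotient.mkₐ k I)
    (Ideal.Quotient.mkₐ_surjective k I) (Ideal.Quotient.mkₐ k J)
    (Ideal.Quotient.mkₐ_surjective k J) (∑ j, N j) q hqdeg (fun i ↦ ?_)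
    (fun i ↦ Ideal.Quotient.eq_zero_iff_mem.mpr (hqJ i)) hx hy
  exact (Ideal.Quotient.eq.mpr (hqI i)).symm

/-! ### The projective dimension theorem -/

theorem MvPolynomial.irrelevant_isPrime (m : ℕ) (k : Type*) [Field k] :
    (HomogeneousIdeal.irrelevant
      (MvPolynomial.homogeneousSubmodule (Fin m) k)).toIdeal.IsPrime := by
  have : (HomogeneousIdeal.irrelevant (MvPolynomial.homogeneousSubmodule (Fin m) k)).toIdeal =
      RingHom.ker (MvPolynomial.constantCoeff (σ := Fin m) (R := k)) := by
    ext p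
    change (MvPolynomial.decomposition.decompose' p 0 : MvPolynomial (Fin m) k) = 0 ↔ _
    rw [MvPolynomial.decomposition.decompose'_apply, MvPolynomial.homogeneousComponent_zero,
      RingHom.mem_ker, MvPolynomial.constantCoeff_eq, MvPolynomial.C_eq_zero]
  rw [this]
  exact RingHom.ker_isPrime _

/-- A relevant homogeneous prime ideal is strictly contained in the irrelevant ideal. -/
theorem ProjectiveSpectrum.lt_irrelevant {m : ℕ} {k : Type*} [Field k]
    (x : ProjectiveSpectrum (MvPolynomial.homogeneousSubmodule (Fin m) k)) :
    x.asHomogeneousIdeal.toIdeal < (HomogeneousIdeal.irrelevant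
      (MvPolynomial.homogeneousSubmodule (Fin m) k)).toIdeal := by
  refine lt_of_le_not_ge (fun p hp ↦ ?_) x.not_irrelevant_le
  have h0 := x.asHomogeneousIdeal.isHomogeneous 0 hp
  change (MvPolynomial.decomposition.decompose' p 0 : MvPolynomial (Fin m) k) = 0
  change (MvPolynomial.decomposition.decompose' p 0 : MvPolynomial (Fin m) k) ∈
    x.asHomogeneousIdeal.toIdeal at h0
  rw [MvPolynomial.decomposition.decompose'_apply, MvPolynomial.homogeneousComponent_zero] at h0 ⊢
  by_contra h
  refine x.isPrime.ne_top (Ideal.eq_top_of_isUnit_mem _ h0 ?_)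
  rw [MvPolynomial.C_eq_zero] at h
  exact (IsUnit.mk0 _ h).map MvPolynomial.C

theorem ProjectiveSpectrum.le_ringKrullDim_quotient {m n : ℕ} {k : Type*} [Field k]
    (p : Fin (n + 1) → ProjectiveSpectrum (MvPolynomial.homogeneousSubmodule (Fin m) k))
    (hp : StrictMono p) :
    ((n + 1 : ℕ) : WithBot ℕ∞) ≤
      ringKrullDim (MvPolynomial (Fin m) k ⧸ (p 0).asHomogeneousIdeal.toIdeal) := by
  rw [ringKrullDim_quotient]
  let I := (p 0).asHomogeneousIdeal.toIdeal
  have h0 (i) : I ≤ (p i).asHomogeneousIdeal.toIdeal := hp.monotone (Fin.zero_le i)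
  let s : LTSeries (PrimeSpectrum.zeroLocus (I : Set (MvPolynomial (Fin m) k))) :=
    LTSeries.mk n (fun i ↦ ⟨⟨(p i).asHomogeneousIdeal.toIdeal, (p i).isPrime⟩, h0 i⟩)
      fun i j hij ↦ hp hij
  -- The vertex of the cone lengthens the chain by one.
  let t := s.snoc ⟨⟨_, MvPolynomial.irrelevant_isPrime m k⟩, (p 0).lt_irrelevant.le⟩
    (p (Fin.last n)).lt_irrelevant
  exact Order.LTSeries.length_le_krullDim t

/-- The radical of a homogeneous ideal is the intersection of the homogeneous primes above it. A
relevant prime above both ideals would be a common specialization, so all these primes contain the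
irrelevant ideal. -/
theorem ProjectiveSpectrum.mem_radical_of_disjoint {m : ℕ} {k : Type*} [Field k]
    (x y : ProjectiveSpectrum (MvPolynomial.homogeneousSubmodule (Fin m) k))
    (h : ∀ z, x ≤ z → ¬ y ≤ z) (i : Fin m) :
    MvPolynomial.X i ∈ (x.asHomogeneousIdeal.toIdeal ⊔ y.asHomogeneousIdeal.toIdeal).radical := by
  rw [Ideal.IsHomogeneous.radical_eq (x.asHomogeneousIdeal.isHomogeneous.sup
    y.asHomogeneousIdeal.isHomogeneous), Ideal.mem_sInf]
  rintro P ⟨hP, hle, hprime⟩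
  by_contra hi
  refine h ⟨⟨P, hP⟩, hprime, fun hirr ↦ hi (hirr ?_)⟩ (le_sup_left.trans hle)
    (le_sup_right.trans hle)
  exact HomogeneousIdeal.mem_irrelevant_of_mem _ Nat.one_pos (MvPolynomial.isHomogeneous_X k i)

/-- Projective dimension theorem: if two points of `ℙᵐ` have disjoint closures, then the lengths of
chains of specializations starting at them add up to less than `m`. -/
theorem ProjectiveSpectrum.add_lt_of_disjoint {m a b : ℕ} {k : Type*} [Field k]
    (p : Fin (a + 1) → ProjectiveSpectrum (MvPolynomial.homogeneousSubmodule (Fin (m + 1)) k))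
    (q : Fin (b + 1) → ProjectiveSpectrum (MvPolynomial.homogeneousSubmodule (Fin (m + 1)) k))
    (hp : StrictMono p) (hq : StrictMono q) (h : ∀ z, p 0 ≤ z → ¬ q 0 ≤ z) : a + b < m := by
  -- On cones the inequality reads `(a + 1) + (b + 1) ≤ m + 1`.
  have := card_le_of_pow_mem_sup _ _ (p 0).asHomogeneousIdeal.isHomogeneous
    (q 0).asHomogeneousIdeal.isHomogeneous (mem_radical_of_disjoint _ _ h)
    (le_ringKrullDim_quotient p hp) (le_ringKrullDim_quotient q hq)
  omega

/-! ### Coordinate subspaces and the standard flag -/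

section Coordinate

variable {σ : Type*} (k : Type*) [Field k] (s : Set σ)

/-- Setting the variables in `s` to zero changes a polynomial only by an element of the span. -/
theorem MvPolynomial.span_X_image_eq_ker [DecidablePred (· ∈ s)] :
    Ideal.span (MvPolynomial.X (R := k) '' s) =
      RingHom.ker (MvPolynomial.aeval (R := k)
        fun i ↦ if i ∈ s then 0 else MvPolynomial.X (R := k) i) := by
  refine le_antisymm (Ideal.span_le.mpr ?_) fun p hp ↦ ?_
  · rintro _ ⟨i, hi, rfl⟩
    simp [hi]
  · have key (p : MvPolynomial σ k) : p - MvPolynomial.aeval (R := k)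
        (fun i ↦ if i ∈ s then 0 else MvPolynomial.X (R := k) i) p ∈
        Ideal.span (MvPolynomial.X (R := k) '' s) := by
      induction p using MvPolynomial.induction_on with
      | C c => simp [MvPolynomial.algebraMap_eq]
      | add p q hp hq =>
        rw [map_add, add_sub_add_comm]
        exact add_mem hp hq
      | mul_X p i hp =>
        by_cases hi : i ∈ s
        · simpa [hi] using Ideal.mul_mem_left _ p
            (Ideal.subset_span (Set.mem_image_of_mem (MvPolynomial.X (R := k)) hi))
        · simpa [hi, ← sub_mul] using Ideal.mul_mem_right _ _ hp
    have := key p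
    rwa [RingHom.mem_ker.mp hp, sub_zero] at this

theorem MvPolynomial.isPrime_span_X_image : (Ideal.span (MvPolynomial.X (R := k) '' s)).IsPrime := by
  classical
  rw [MvPolynomial.span_X_image_eq_ker]
  exact RingHom.ker_isPrime _

variable {s} in
theorem MvPolynomial.X_mem_span_X_image {i : σ} :
    MvPolynomial.X i ∈ Ideal.span (MvPolynomial.X (R := k) '' s) ↔ i ∈ s := by
  classical
  rw [MvPolynomial.span_X_image_eq_ker, RingHom.mem_ker, MvPolynomial.aeval_X]
  simp

end Coordinate

/-- The generic point of the linear subspace `x₀ = ⋯ = xᵢ₋₁ = 0` of projective space. -/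
def linearSubspacePoint (n : ℕ) (k : Type*) [Field k] (i : Fin (n + 1)) :
    ProjectiveSpectrum (MvPolynomial.homogeneousSubmodule (Fin (n + 1)) k) where
  asHomogeneousIdeal := ⟨Ideal.span (MvPolynomial.X '' Set.Iio i),
    Ideal.homogeneous_span _ _ (by
      rintro _ ⟨j, -, rfl⟩
      exact ⟨1, MvPolynomial.isHomogeneous_X k j⟩)⟩
  isPrime := MvPolynomial.isPrime_span_X_image k _
  not_irrelevant_le h := by
    have : MvPolynomial.X i ∈ Ideal.span (MvPolynomial.X (R := k) '' Set.Iio i) :=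
      h (HomogeneousIdeal.mem_irrelevant_of_mem _ Nat.one_pos (MvPolynomial.isHomogeneous_X k i))
    rw [MvPolynomial.X_mem_span_X_image] at this
    exact lt_irrefl i this

theorem linearSubspacePoint_strictMono (n : ℕ) (k : Type*) [Field k] :
    StrictMono (linearSubspacePoint n k) := by
  intro i j hij
  refine lt_of_le_not_ge (Ideal.span_mono (Set.image_mono (Set.Iio_subset_Iio hij.le))) fun h ↦ ?_
  have : MvPolynomial.X i ∈ Ideal.span (MvPolynomial.X (R := k) '' Set.Iio i) :=
    h (Ideal.subset_span ⟨i, hij, rfl⟩)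
  rw [MvPolynomial.X_mem_span_X_image] at this
  exact lt_irrefl i this

/-- Two disjoint closed subsets of `ℙᵐ` homeomorphic to `ℙⁿ` force `2n < m`. -/
theorem two_mul_lt_of_disjoint_range {n m : ℕ} {k : Type*} [Field k]
    {g h : ProjectiveSpectrum (MvPolynomial.homogeneousSubmodule (Fin (n + 1)) k) →
      ProjectiveSpectrum (MvPolynomial.homogeneousSubmodule (Fin (m + 1)) k)}
    (hg : Topology.IsClosedEmbedding g) (hh : Topology.IsClosedEmbedding h)
    (hd : ∀ x y, g x ≠ h y) : 2 * n < m := by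
  have mono {g : ProjectiveSpectrum (MvPolynomial.homogeneousSubmodule (Fin (n + 1)) k) →
      ProjectiveSpectrum (MvPolynomial.homogeneousSubmodule (Fin (m + 1)) k)}
      (hg : Topology.IsClosedEmbedding g) : StrictMono g := by
    -- The order is specialization, which continuous maps preserve.
    refine Monotone.strictMono_of_injective (fun x y hxy ↦ ?_) hg.injective
    rw [ProjectiveSpectrum.le_iff_mem_closure, ← specializes_iff_mem_closure] at hxy ⊢
    exact hxy.map hg.continuous
  have mem {g : ProjectiveSpectrum (MvPolynomial.homogeneousSubmodule (Fin (n + 1)) k) →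
      ProjectiveSpectrum (MvPolynomial.homogeneousSubmodule (Fin (m + 1)) k)}
      (hg : Topology.IsClosedEmbedding g) {x z} (hz : g x ≤ z) : z ∈ Set.range g := by
    rw [ProjectiveSpectrum.le_iff_mem_closure] at hz
    exact closure_minimal (by simp) hg.isClosed_range hz
  have := ProjectiveSpectrum.add_lt_of_disjoint _ _
    ((mono hg).comp (linearSubspacePoint_strictMono n k))
    ((mono hh).comp (linearSubspacePoint_strictMono n k)) fun z hz hz' ↦ by
      obtain ⟨x, rfl⟩ := mem hg hz
      obtain ⟨y, hy⟩ := mem hh hz'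
      exact hd x y hy.symm
  omega

universe u

/-! ### Rational points of the line and the slices over them -/

section RationalPoints

variable (k : Type u) [Field k]

theorem MvPolynomial.X_mem_homogeneousSubmodule {σ : Type*} (i : σ) :
    MvPolynomial.X i ∈ MvPolynomial.homogeneousSubmodule σ k 1 :=
  MvPolynomial.isHomogeneous_X k i

/-- Evaluation of the affine coordinate ring of the chart `x₀ ≠ 0` of `ℙ¹` at the point `(1 : c)`. -/
def awayEval (c : k) :
    HomogeneousLocalization.Away (MvPolynomial.homogeneousSubmodule (Fin (1 + 1)) k)
      (MvPolynomial.X 0) →+* k :=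
  (IsLocalization.Away.lift (S := Localization.Away (MvPolynomial.X (R := k) (0 : Fin (1 + 1))))
    (MvPolynomial.X (R := k) (0 : Fin (1 + 1))) (g := (MvPolynomial.eval ![1, c])) (by simp)).comp
    (algebraMap (HomogeneousLocalization.Away (MvPolynomial.homogeneousSubmodule (Fin (1 + 1)) k)
      (MvPolynomial.X 0)) (Localization.Away (MvPolynomial.X (R := k) (0 : Fin (1 + 1)))))

/-- The denominator is a power of `X 0`, which takes the value `1` at `(1 : c)`. -/
theorem awayEval_eq {c : k} (t : HomogeneousLocalization.Away
      (MvPolynomial.homogeneousSubmodule (Fin (1 + 1)) k) (MvPolynomial.X 0))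
    (p : MvPolynomial (Fin (1 + 1)) k)
    (s : Submonoid.powers (MvPolynomial.X (R := k) (0 : Fin (1 + 1))))
    (ht : t.val = Localization.mk p s) : awayEval k c t = MvPolynomial.eval ![1, c] p := by
  have hu : IsUnit (MvPolynomial.eval ![1, c] (MvPolynomial.X 0)) := by simp
  change IsLocalization.Away.lift (S := Localization.Away (MvPolynomial.X (R := k) (0 : Fin (1 + 1))))
    (MvPolynomial.X (R := k) (0 : Fin (1 + 1))) hu t.val = _
  rw [ht, Localization.mk_eq_mk']
  refine (IsLocalization.lift_mk'_spec (M := Submonoid.powers (MvPolynomial.X 0)) _ _ _ _).mpr ?_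
  obtain ⟨_, j, rfl⟩ := s
  simp

/-- The rational point `(1 : c)` of `ℙ¹`. -/
def affinePoint (c : k) : Spec (CommRingCat.of k) ⟶ projectiveSpace k 1 :=
  Spec.map (CommRingCat.ofHom (awayEval k c)) ≫
    Proj.awayι (MvPolynomial.homogeneousSubmodule (Fin (1 + 1)) k) (MvPolynomial.X 0)
      (MvPolynomial.X_mem_homogeneousSubmodule k 0) Nat.one_pos

theorem awayEval_comp_fromZeroRingHom (c : k) :
    ((awayEval k c).comp (HomogeneousLocalization.fromZeroRingHom
        (MvPolynomial.homogeneousSubmodule (Fin (1 + 1)) k) _)).comp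
      (algebraMap k (MvPolynomial.homogeneousSubmodule (Fin (1 + 1)) k 0)) = RingHom.id k := by
  ext a
  refine (awayEval_eq k _ _ 1 (HomogeneousLocalization.val_mk _)).trans ?_
  exact MvPolynomial.eval_C a

theorem affinePoint_comp (c : k) : affinePoint k c ≫ projectiveSpaceToSpec k 1 = 𝟙 _ := by
  let 𝒜 := MvPolynomial.homogeneousSubmodule (Fin (1 + 1)) k
  let ι : Spec _ ⟶ Proj 𝒜 := Proj.awayι 𝒜 (MvPolynomial.X 0)
    (MvPolynomial.X_mem_homogeneousSubmodule k 0) Nat.one_pos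
  have h : (Spec.map (CommRingCat.ofHom (awayEval k c)) ≫ ι) ≫ Proj.toSpecZero 𝒜 ≫
      Spec.map (CommRingCat.ofHom (algebraMap k (𝒜 0))) = 𝟙 _ := by
    rw [Category.assoc, Proj.awayι_toSpecZero_assoc, ← Spec.map_comp, ← Spec.map_comp,
      ← CommRingCat.ofHom_comp, ← CommRingCat.ofHom_comp]
    exact (congrArg (fun φ ↦ Spec.map (CommRingCat.ofHom φ))
      (awayEval_comp_fromZeroRingHom k c)).trans (Spec.map_id _)
  exact h

theorem affinePoint_zero_ne_one (x y : Spec (CommRingCat.of k)) :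
    affinePoint k 0 x ≠ affinePoint k 1 y := by
  intro h
  simp only [affinePoint] at h
  have h' := (Proj.awayι (MvPolynomial.homogeneousSubmodule (Fin (1 + 1)) k) (MvPolynomial.X 0)
    (MvPolynomial.X_mem_homogeneousSubmodule k 0) Nat.one_pos).isOpenEmbedding.injective h
  have h0 (c : k) (x : PrimeSpectrum k) (a) :
      a ∈ (PrimeSpectrum.comap (awayEval k c) x).asIdeal ↔ awayEval k c a = 0 := by
    change awayEval k c a ∈ x.asIdeal ↔ _
    rw [Ideal.eq_bot_of_prime x.asIdeal, Ideal.mem_bot]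
  -- The affine coordinate `X 1 / X 0`, with value `c` at `(1 : c)`: it vanishes at the first point
  -- but not at the second.
  let t := HomogeneousLocalization.Away.isLocalizationElem
    (MvPolynomial.X_mem_homogeneousSubmodule k (0 : Fin (1 + 1)))
    (MvPolynomial.X_mem_homogeneousSubmodule k (1 : Fin (1 + 1)))
  have ht (c : k) : awayEval k c t = c :=
    (awayEval_eq k _ _ _ (HomogeneousLocalization.Away.val_mk _ _ _ _ _)).trans (by simp)
  have h2 : PrimeSpectrum.comap (awayEval k 0) x = PrimeSpectrum.comap (awayEval k 1) y := h'
  have h1 := (h0 0 x t).mpr (ht 0)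
  rw [h2] at h1
  exact one_ne_zero ((ht 1).symm.trans ((h0 1 y t).mp h1))

variable (n : ℕ)

instance : IsSeparated (projectiveSpaceToSpec k n) := by
  unfold projectiveSpaceToSpec
  have h1 : IsSeparated (Proj.toSpecZero (MvPolynomial.homogeneousSubmodule (Fin (n + 1)) k)) :=
    Proj.isSeparated _
  have h2 : IsSeparated (Spec.map (CommRingCat.ofHom
    (algebraMap k (MvPolynomial.homogeneousSubmodule (Fin (n + 1)) k 0)))) := inferInstance
  exact MorphismProperty.comp_mem _ _ _ h1 h2

/-- The inclusion `ℙⁿ ≅ ℙⁿ × {(1 : c)} ⟶ ℙⁿ × ℙ¹`. -/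
def sliceInclusion (c : k) : projectiveSpace k n ⟶ projectiveProduct k n 1 :=
  pullback.lift (𝟙 _) (projectiveSpaceToSpec k n ≫ affinePoint k c) (by
    rw [Category.assoc, affinePoint_comp, Category.id_comp, Category.comp_id])

/-- The first projection is separated, as a base change of `g`, so the closed immersion `𝟙 X = s ≫
pullback.fst f g` can be cancelled on the right. -/
theorem isClosedImmersion_of_section_fst {X Y S : Scheme.{u}} (f : X ⟶ S) (g : Y ⟶ S)
    [IsSeparated g] (s : X ⟶ pullback f g) (h : s ≫ pullback.fst f g = 𝟙 X) :
    IsClosedImmersion s := by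
  have : IsClosedImmersion (s ≫ pullback.fst f g) := by
    rw [h]
    infer_instance
  exact IsClosedImmersion.of_comp s (pullback.fst f g)

instance (c : k) : IsClosedImmersion (sliceInclusion k n c) :=
  isClosedImmersion_of_section_fst _ _ _ (pullback.lift_fst _ _ _)

/-- The second projection sends the two slices to the distinct points `(1 : 0)` and `(1 : 1)`. -/
theorem sliceInclusion_zero_ne_one (x y : projectiveSpace k n) :
    sliceInclusion k n 0 x ≠ sliceInclusion k n 1 y := by
  intro h
  have key (c : k) (x : projectiveSpace k n) :
      pullback.snd (projectiveSpaceToSpec k n) (projectiveSpaceToSpec k 1)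
        (sliceInclusion k n c x) = affinePoint k c (projectiveSpaceToSpec k n x) := by
    have : sliceInclusion k n c ≫ pullback.snd (projectiveSpaceToSpec k n)
      (projectiveSpaceToSpec k 1) = projectiveSpaceToSpec k n ≫ affinePoint k c :=
        pullback.lift_snd _ _ _
    exact congr($this x)
  exact affinePoint_zero_ne_one k _ _ ((key 0 x).symm.trans ((congrArg _ h).trans (key 1 y)))

end RationalPoints

end

theorem mainTheorem10 (k : Type*) [Field k] (n m : ℕ)
    (f : projectiveProduct k n 1 ⟶ projectiveSpace k m)
    (hf_over : f ≫ projectiveSpaceToSpec k m = projectiveProductToSpec k n 1)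
    (hf_closed : IsClosedImmersion f) :
    2 * n + 1 ≤ m := by
  have h (c : k) := (sliceInclusion k n c ≫ f).isClosedEmbedding
  refine two_mul_lt_of_disjoint_range (k := k) (h 0) (h 1) fun x y hxy ↦ ?_
  exact sliceInclusion_zero_ne_one k n x y (f.isClosedEmbedding.injective hxy)
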